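/- All graphs are finite and non-empty, have no loops and may have parallel edges; every edge has one of the two colours $1,2$ (a 2-edge-coloured graph). A path is alternating if consecutive edges have different colours; a cycle has at least three vertices, and it is alternating if cyclically consecutive edges have different colours. An alternating cycle of $G$ is hamiltonian if it contains all vertices of $G$, and an alternating cycle factor of $G$ is a collection of pairwise vertex-disjoint alternating cycles of $G$ that together cover $V(G)$. The graph $G$ is colour-connected if for all distinct vertices $u,v$ there are two alternating $(u,v)$-paths $P_1,P_2$ such that the closed walk that follows $P_1$ from $u$ to $v$ and then $P_2$ backwards from $v$ to $u$ is alternating (its last and first edge included). A 2-edge-coloured graph is M-closed if, whenever $x,y,z$ are distinct vertices and there are an edge $xy$ and an edge $yz$ of the same colour, $x$ and $z$ are adjacent. An extension of a 2-edge-coloured graph $G_0$ with vertices $v_1,\dots,v_n$ is a graph obtained from $G_0$ by replacing each $v_i$ by an independent set $I_i$ of $p_i\ge 1$ vertices and each edge $v_iv_j$ of colour $c$ by edges of colour $c$, one between each vertex of $I_i$ and each vertex of $I_j$. **Theorem.** Let $G$ be an extension of an M-closed 2-edge-coloured graph. Then $G$ has an alternating hamiltonian cycle if and only if $G$ is colour-connected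 and has an alternating cycle factor. -/

import Mathlib

/-! Multigraphs are `Graph α β` (vertices in `α`, edges in `β`, parallel edges allowed).
A 2-edge-colouring is a function `φ : β → Fin 2`; only its values on edges of the graph matter. -/

namespace Graph

/-- `G.IsWalkList u w v`: the list `w = [(e₁, x₁), …, (eₖ, xₖ)]` describes the walk
`u e₁ x₁ e₂ x₂ … eₖ xₖ = v` of `G`. -/
def IsWalkList {α β : Type*} (G : Graph α β) : α → List (β × α) → α → Prop
  | u, [], v => u ∈ G.vertexSet ∧ u = v
  | u, (e, x) :: w, v => G.IsLink e u x ∧ G.IsWalkList x w v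

/-- The sequence of colours of the edges of a walk. -/
def colourSeq {α β : Type*} (φ : β → Fin 2) (w : List (β × α)) : List (Fin 2) :=
  w.map fun s => φ s.1

/-- `w` is an alternating `(u, v)`-path: a walk from `u` to `v` without repeated vertices,
in which consecutive edges have different colours. -/
structure IsAltPath {α β : Type*} (G : Graph α β) (φ : β → Fin 2)
    (u : α) (w : List (β × α)) (v : α) : Prop where
  walk : G.IsWalkList u w v
  nodup : (u :: w.map Prod.snd).Nodup
  alternating : (colourSeq φ w).IsChain (· ≠ ·)

/-- `w` is an alternating cycle: a closed walk on at least three vertices, in which no vertex is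
repeated (except that the walk returns to its start) and cyclically consecutive edges, including
the last and the first one, have different colours. -/
structure IsAltCycle {α β : Type*} (G : Graph α β) (φ : β → Fin 2)
    (w : List (β × α)) : Prop where
  closed : ∃ u, G.IsWalkList u w u
  three_le : 3 ≤ w.length
  nodup : (w.map Prod.snd).Nodup
  alternating : Cycle.Chain (· ≠ ·) (colourSeq φ w : Cycle (Fin 2))

/-- The vertex set of a cycle given as a list of steps. -/
def cycleVerts {α β : Type*} (w : List (β × α)) : Set α :=
  {x | x ∈ w.map Prod.snd}

/-- `G` has an alternating hamiltonian cycle. -/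
def HasAltHamCycle {α β : Type*} (G : Graph α β) (φ : β → Fin 2) : Prop :=
  ∃ w, G.IsAltCycle φ w ∧ cycleVerts w = G.vertexSet

/-- `G` has an alternating cycle factor: a collection of disjoint alternating cycles that
cover all vertices. -/
def HasAltCycleFactor {α β : Type*} (G : Graph α β) (φ : β → Fin 2) : Prop :=
  ∃ C : Set (List (β × α)), (∀ w ∈ C, G.IsAltCycle φ w) ∧ C.PairwiseDisjoint cycleVerts ∧
    ⋃ w ∈ C, cycleVerts w = G.vertexSet

/-- `G` is colour-connected: any two distinct vertices `u`, `v` are joined by two alternating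
`(u, v)`-paths `p`, `q` whose union, that is, the closed walk which follows `p` from `u` to `v`
and then `q` backwards from `v` to `u`, is alternating (as a closed walk). -/
def ColourConnected {α β : Type*} (G : Graph α β) (φ : β → Fin 2) : Prop :=
  ∀ u ∈ G.vertexSet, ∀ v ∈ G.vertexSet, u ≠ v →
    ∃ p q, G.IsAltPath φ u p v ∧ G.IsAltPath φ u q v ∧
      Cycle.Chain (· ≠ ·) (colourSeq φ p ++ (colourSeq φ q).reverse : Cycle (Fin 2))

/-- `G` is M-closed: the end-vertices of every monochromatic path with two edges are adjacent. -/
def MClosed {α β : Type*} (G : Graph α β) (φ : β → Fin 2) : Prop :=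
  ∀ e f x y z, G.IsLink e x y → G.IsLink f y z → x ≠ y → y ≠ z → x ≠ z → φ e = φ f → G.Adj x z

/-- `H` (coloured by `ψ`) is an extension of the loopless multigraph `G` (coloured by `φ`): each
vertex `v` of `G` is replaced by the non-empty set of the vertices `x` of `H` with `π x = v`, and
there are as many edges of colour `c` between `x` and `y` in `H` as there are between `π x` and
`π y` in `G`. In particular there are none if `π x = π y`, so the sets are independent. -/
def IsExtension {α β γ δ : Type*} (G : Graph α β) (φ : β → Fin 2)
    (H : Graph γ δ) (ψ : δ → Fin 2) : Prop :=
  ∃ π : γ → α, π '' H.vertexSet = G.vertexSet ∧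
    ∀ x ∈ H.vertexSet, ∀ y ∈ H.vertexSet, ∀ c : Fin 2,
      {f | H.IsLink f x y ∧ ψ f = c}.encard = {e | G.IsLink e (π x) (π y) ∧ φ e = c}.encard

end Graph

/-! A hamiltonian cycle is itself a factor, and cutting it at two vertices gives the two paths. For
the converse, take an alternating cycle factor with as few cycles as possible: no union of two or
more of its cycles is spanned by an alternating cycle. Each structural statement below holds because
its failure would merge cycles.

Vertices on different cycles are never twins, so between cycles the extension behaves like an
M-closed graph. Double counting (`block_structure`) shows that adjacency is all or nothing on the
four pairs between two factor edges of the same colour, and that each edge `xy` between cycles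
changes colour when both ends move to their partners (`flip`). An exchange argument (`rot_left`)
makes the colour depend only on the bipartition classes of the ends. Hence of two adjacent cycles
one dominates the other: each of its vertices sees the whole other cycle in one colour
(`dom_or_dom`).

Adjacency of cycles is transitive, so connectivity makes all pairs of cycles adjacent. Domination
has no directed triangle, so it is a transitive tournament with a source. A vertex of the source
cycle sees everything outside in one colour; an alternating walk that starts there with the other
colour can never leave the cycle (`f_eq`). This contradicts colour-connectivity if there is a second
cycle. -/

namespace AltColour

/-- `Seg R c S a b`: there is an alternating path from `a` to `b` with vertex set `S` whose first
and last edge have the colour `!c`, so that it can be prolonged at both ends by edges of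
colour `c`. -/
inductive Seg {V : Type*} (R : Bool → V → V → Prop) (c : Bool) : Set V → V → V → Prop
  | edge {a b : V} : a ≠ b → R (!c) a b → Seg R c {a, b} a b
  | append {S T : Set V} {a b d e : V} : Seg R c S a b → Seg R c T d e → Disjoint S T →
      R c b d → Seg R c (S ∪ T) a e

/-- An alternating cycle factor that cannot be improved by merging some of its cycles: `f` labels
the vertices by the cycles, `p c x` is the neighbour of `x` on its cycle along the edge of
colour `c`, and `cl` is a bipartition of the cycles. -/
structure MinFactor {V : Type*} (R : Bool → V → V → Prop) where
  f : V → V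
  p : Bool → V → V
  cl : V → Bool
  rel : ∀ c x, R c x (p c x)
  invol : ∀ c x, p c (p c x) = x
  f_p : ∀ c x, f (p c x) = f x
  p_ne : ∀ x, p true x ≠ p false x
  cl_p : ∀ c x, cl (p c x) = !cl x
  trans : ∀ x y, f x = f y → cl x = cl y → ∃ n : ℕ, (fun z => p true (p false z))^[n] x = y
  whole : ∀ c x, Seg R c {z | f z = f x} (p c x) x
  split : ∀ c x t, f x = f t → cl x = cl t → x ≠ t → ∃ S T, Disjoint S T ∧
    S ∪ T = {z | f z = f x} ∧ Seg R c S (p c x) t ∧ Seg R c T (p c t) x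
  irreducible : ∀ (T : Set V) x y, f x ∈ T → f y ∈ T → f x ≠ f y → ∀ c a b,
    Seg R c {z | f z ∈ T} a b → ¬ R c b a

/-- Adjacency by an edge of any colour. -/
def Adj {V : Type*} (R : Bool → V → V → Prop) (x y : V) : Prop :=
  ∃ d, R d x y

/-! ### Adjacency counts between two cycles of an irreducible factor. -/

variable {V : Type*} {R : Bool → V → V → Prop}

theorem Adj.symm (hs : ∀ c x y, R c x y → R c y x) {x y} (h : Adj R x y) : Adj R y x :=
  h.imp fun _ => hs _ _ _

theorem Adj.of_not {d x y} (h : Adj R x y) (h' : ¬ R (!d) x y) : R d x y := by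
  obtain ⟨e, he⟩ := h
  cases d <;> cases e <;> simp_all

theorem Seg.symm (hs : ∀ c x y, R c x y → R c y x) {c S a b} (h : Seg R c S a b) :
    Seg R c S b a := by
  induction h with
  | edge hab h => rw [Set.pair_comm]; exact .edge hab.symm (hs _ _ _ h)
  | append _ _ hd h ih₁ ih₂ => rw [Set.union_comm]; exact ih₂.append ih₁ hd.symm (hs _ _ _ h)

-- The indices 1, 2, 3, 4 stand for the pairs `xy`, `x'y`, `xy'`, `x'y'`, with primes for partners;
-- the `B` are pairs joined in the chosen colour, the `A` adjacent pairs. One coloured pair already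
-- forces three adjacent ones, and two force all four. The diagonals 1, 4 and 2, 3 carry at most one
-- coloured pair each, so equality with `A₁` needs exactly one on each.
open Classical in
theorem block_count {B₁ B₂ B₃ B₄ A₁ A₂ A₃ A₄ : Prop} (h₁ : B₁ → ¬ B₄) (h₂ : B₂ → ¬ B₃)
    (l₁ : B₁ → A₁ ∧ A₂ ∧ A₃) (l₂ : B₂ → A₂ ∧ A₁ ∧ A₄) (l₃ : B₃ → A₃ ∧ A₄ ∧ A₁)
    (l₄ : B₄ → A₄ ∧ A₃ ∧ A₂) {m n : ℕ}
    (hm : m = (if B₁ then 1 else 0) + (if B₂ then 1 else 0) + (if B₃ then 1 else 0) +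
      (if B₄ then 1 else 0))
    (hn : n = (if A₁ then 1 else 0) + (if A₂ then 1 else 0) + (if A₃ then 1 else 0) +
      (if A₄ then 1 else 0)) :
    2 * m ≤ n ∧ (A₁ → 2 * m = n → A₂ ∧ A₃ ∧ A₄ ∧ (B₁ ↔ ¬ B₄)) := by
  subst hm hn
  by_cases B₁ <;> by_cases B₂ <;> by_cases B₃ <;> by_cases B₄ <;> simp_all <;> lia

namespace MinFactor

variable (F : MinFactor R) (hs : ∀ c x y, R c x y → R c y x)

include hs

/-- Otherwise, deleting the factor edges of colour `c` at `x` and `y` and adding these two edges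
merges the two cycles. -/
theorem no_swap {c x y} (hxy : F.f x ≠ F.f y) (h : R c x y) : ¬ R c (F.p c x) (F.p c y) := by
  intro h'
  have hd : Disjoint {z | F.f z = F.f x} {z | F.f z = F.f y} :=
    Set.disjoint_left.2 fun z h₁ h₂ => hxy (h₁.symm.trans h₂)
  have key := (F.whole c x).append ((F.whole c y).symm hs) hd h
  refine F.irreducible {F.f x, F.f y} x y (by simp) (by simp) hxy c _ _ ?_ (hs _ _ _ h')
  exact key

/-- Twins could exchange their partners, which is a forbidden swap. -/
theorem no_twin {x y} (hxy : F.f x ≠ F.f y) : ¬ ∀ d w, R d x w ↔ R d y w := by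
  intro h
  refine F.no_swap hs (c := true) (x := x) (y := F.p true y) (by rwa [F.f_p])
    ((h _ _).2 (F.rel _ _)) ?_
  rw [F.invol]
  exact hs _ _ _ ((h _ _).1 (F.rel _ _))

variable (hext : ∀ c x y z, R c x y → R c y z →
  Adj R x z ∨ ∀ d w, R d x w ↔ R d z w)

include hext

theorem adj_of_mono {c x y z} (hxz : F.f x ≠ F.f z) (h₁ : R c x y) (h₂ : R c y z) :
    Adj R x z :=
  (hext _ _ _ _ h₁ h₂).resolve_right (F.no_twin hs hxz)

theorem adj_partner_left {c x y} (hxy : F.f x ≠ F.f y) (h : R c x y) : Adj R (F.p c x) y :=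
  F.adj_of_mono hs hext (by rwa [F.f_p]) (hs _ _ _ (F.rel c x)) h

theorem adj_partner_right {c x y} (hxy : F.f x ≠ F.f y) (h : R c x y) :
    Adj R x (F.p c y) :=
  F.adj_of_mono hs hext (by rwa [F.f_p]) h (F.rel c y)

omit hext hs in
theorem sum_partner_left [Fintype V] [DecidableEq V] (c : Bool) (g : V → V → ℕ) :
    ∑ q : V × V with F.f q.1 ≠ F.f q.2, g (F.p c q.1) q.2 =
      ∑ q : V × V with F.f q.1 ≠ F.f q.2, g q.1 q.2 := by
  refine Finset.sum_nbij' (fun q => (F.p c q.1, q.2)) (fun q => (F.p c q.1, q.2)) ?_ ?_ ?_ ?_ ?_ <;>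
    simp [F.f_p, F.invol]

omit hext hs in
theorem sum_partner_right [Fintype V] [DecidableEq V] (c : Bool) (g : V → V → ℕ) :
    ∑ q : V × V with F.f q.1 ≠ F.f q.2, g q.1 (F.p c q.2) =
      ∑ q : V × V with F.f q.1 ≠ F.f q.2, g q.1 q.2 := by
  refine Finset.sum_nbij' (fun q => (q.1, F.p c q.2)) (fun q => (q.1, F.p c q.2)) ?_ ?_ ?_ ?_ ?_ <;>
    simp [F.f_p, F.invol]

open Classical in
theorem block_le {c x y} (hxy : F.f x ≠ F.f y) {m n : ℕ}
    (hm : m = (if R c x y then 1 else 0) + (if R c (F.p c x) y then 1 else 0) +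
      (if R c x (F.p c y) then 1 else 0) + (if R c (F.p c x) (F.p c y) then 1 else 0))
    (hn : n = (if Adj R x y then 1 else 0) + (if Adj R (F.p c x) y then 1 else 0) +
      (if Adj R x (F.p c y) then 1 else 0) +
      (if Adj R (F.p c x) (F.p c y) then 1 else 0)) :
    2 * m ≤ n ∧ (Adj R x y → 2 * m = n → Adj R (F.p c x) y ∧ Adj R x (F.p c y) ∧
      Adj R (F.p c x) (F.p c y) ∧ (R c x y ↔ ¬ R c (F.p c x) (F.p c y))) := by
  have h₁ := F.no_swap hs (c := c) hxy
  have h₂ := F.no_swap hs (c := c) (x := F.p c x) (y := y) (by rwa [F.f_p])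
  have l₁ := F.adj_partner_left hs hext (c := c) hxy
  have l₂ := F.adj_partner_left hs hext (c := c) (x := F.p c x) (y := y) (by rwa [F.f_p])
  have l₃ := F.adj_partner_left hs hext (c := c) (x := x) (y := F.p c y) (by rwa [F.f_p])
  have l₄ := F.adj_partner_left hs hext (c := c) (x := F.p c x) (y := F.p c y)
    (by rwa [F.f_p, F.f_p])
  have r₁ := F.adj_partner_right hs hext (c := c) hxy
  have r₂ := F.adj_partner_right hs hext (c := c) (x := F.p c x) (y := y) (by rwa [F.f_p])
  have r₃ := F.adj_partner_right hs hext (c := c) (x := x) (y := F.p c y) (by rwa [F.f_p])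
  have r₄ := F.adj_partner_right hs hext (c := c) (x := F.p c x) (y := F.p c y)
    (by rwa [F.f_p, F.f_p])
  simp only [F.invol] at h₂ l₂ l₄ r₃ r₄
  exact block_count h₁ h₂ (fun h => ⟨⟨_, h⟩, l₁ h, r₁ h⟩) (fun h => ⟨⟨_, h⟩, l₂ h, r₂ h⟩)
    (fun h => ⟨⟨_, h⟩, l₃ h, r₃ h⟩) (fun h => ⟨⟨_, h⟩, l₄ h, r₄ h⟩) hm hn

/-- Edges between different cycles have no parallel edge of the other colour, all four pairs in
`{x, p c x} × {y, p c y}` are adjacent if one is, and of the pairs `x, y` and `p c x, p c y`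
exactly one is joined by colour `c`. -/
theorem block_structure [Finite V] {x y} (hxy : F.f x ≠ F.f y) (hadj : Adj R x y) (c : Bool) :
    (∀ d, R d x y → ¬ R (!d) x y) ∧ Adj R (F.p c x) y ∧ Adj R x (F.p c y) ∧
      Adj R (F.p c x) (F.p c y) ∧ (R c x y ↔ ¬ R c (F.p c x) (F.p c y)) := by
  classical
  have := Fintype.ofFinite V
  set K := Finset.univ.filter fun q : V × V => F.f q.1 ≠ F.f q.2 with hK
  set A : V → V → ℕ := fun x y => if Adj R x y then 1 else 0 with hA
  set a : Bool → V → V → ℕ := fun c x y => if R c x y then 1 else 0 with ha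
  have hblock : ∀ c, ∀ q ∈ K, 2 * (a c q.1 q.2 + a c (F.p c q.1) q.2 + a c q.1 (F.p c q.2) +
      a c (F.p c q.1) (F.p c q.2)) ≤
      A q.1 q.2 + A (F.p c q.1) q.2 + A q.1 (F.p c q.2) + A (F.p c q.1) (F.p c q.2) :=
    fun c q hq => (F.block_le hs hext (by simpa [hK] using hq) rfl rfl).1
  -- Moving either end to its partner permutes the pairs in `K`, so each pair is counted by four
  -- blocks.
  have hsum : ∀ c (g : V → V → ℕ), ∑ q ∈ K, (g q.1 q.2 + g (F.p c q.1) q.2 + g q.1 (F.p c q.2) +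
      g (F.p c q.1) (F.p c q.2)) = 4 * ∑ q ∈ K, g q.1 q.2 := by
    intro c g
    simp only [Finset.sum_add_distrib]
    rw [F.sum_partner_left c g, F.sum_partner_right c g,
      F.sum_partner_left c fun x y => g x (F.p c y), F.sum_partner_right c g]
    ring
  have hle : ∀ c, 2 * ∑ q ∈ K, a c q.1 q.2 ≤ ∑ q ∈ K, A q.1 q.2 := by
    intro c
    have h := Finset.sum_le_sum (hblock c)
    rw [← Finset.mul_sum, hsum, hsum] at h
    lia
  have hpt : ∀ q ∈ K, A q.1 q.2 ≤ a true q.1 q.2 + a false q.1 q.2 := by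
    intro q _
    by_cases h : Adj R q.1 q.2
    · obtain ⟨_ | _, hd⟩ := h <;> simp only [hA, ha, hd, if_true] <;> split_ifs <;> simp
    · simp [hA, h]
  have htot := Finset.sum_le_sum hpt
  rw [Finset.sum_add_distrib] at htot
  have h₀ := hle false
  have h₁ := hle true
  have hq : (x, y) ∈ K := by simpa [hK] using hxy
  -- Each colour takes at most half of the adjacent pairs, yet the two colours together cover them
  -- all. So every inequality is an equality, for this pair and for its block.
  have e₁ := (Finset.sum_eq_sum_iff_of_le hpt).1 (by rw [Finset.sum_add_distrib]; lia) (x, y) hq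
  have hc : 2 * ∑ q ∈ K, a c q.1 q.2 = ∑ q ∈ K, A q.1 q.2 := by
    have := hle c
    cases c <;> lia
  have e₂ := (Finset.sum_eq_sum_iff_of_le (hblock c)).1
    (by rw [← Finset.mul_sum, hsum, hsum]; lia) (x, y) hq
  refine ⟨?_, (F.block_le hs hext hxy rfl rfl).2 hadj e₂⟩
  simp only [hA, ha, if_pos hadj] at e₁
  rintro (_ | _) h₁ h₂ <;> simp only [Bool.not_true, Bool.not_false] at h₂ <;>
    simp [h₁, h₂] at e₁

end MinFactor
end AltColour

/-! ### Colours between the classes of two cycles. -/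

namespace AltColour
namespace MinFactor

variable {V : Type*} {R : Bool → V → V → Prop}
variable (F : MinFactor R) (hs : ∀ c x y, R c x y → R c y x)
variable (hext : ∀ c x y z, R c x y → R c y z → Adj R x z ∨ ∀ d w, R d x w ↔ R d z w)

/-- The rotation of the cycles by two steps. -/
def rot (x : V) : V := F.p true (F.p false x)

theorem f_rot (x : V) : F.f (F.rot x) = F.f x := by simp [rot, F.f_p]

theorem cl_rot (x : V) : F.cl (F.rot x) = F.cl x := by simp [rot, F.cl_p]

theorem rot_ne (x : V) : F.rot x ≠ x := by
  intro h
  have := congrArg (F.p true) h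
  rw [rot, F.invol] at this
  exact F.p_ne x this.symm

theorem rot_injective : Function.Injective F.rot := by
  intro x y h
  have := congrArg (fun z => F.p false (F.p true z)) h
  simpa [rot, F.invol] using this

include hs hext
variable [Finite V]

theorem colour_unique {d x y} (hxy : F.f x ≠ F.f y) (h : R d x y) : ¬ R (!d) x y :=
  (F.block_structure hs hext hxy ⟨d, h⟩ true).1 d h

theorem colour_eq {d e x y} (hxy : F.f x ≠ F.f y) (h : R d x y) (h' : R e x y) : d = e := by
  by_contra hne
  have : e = !d := by cases d <;> cases e <;> simp_all
  exact F.colour_unique hs hext hxy h (this ▸ h')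

theorem adj_right {x y} (hxy : F.f x ≠ F.f y) (h : Adj R x y) (c : Bool) : Adj R x (F.p c y) :=
  (F.block_structure hs hext hxy h c).2.2.1

/-- For `c = d` this is the diagonal rule of the block. For the other colour, failure would by the
same rule give `xy` a parallel edge of colour `!d`. -/
theorem flip {d x y} (hxy : F.f x ≠ F.f y) (h : R d x y) (c : Bool) :
    R (!d) (F.p c x) (F.p c y) := by
  obtain ⟨h₁, -, -, ⟨e, he⟩, h₅⟩ := F.block_structure hs hext hxy ⟨d, h⟩ c
  have hxy' : F.f (F.p c x) ≠ F.f (F.p c y) := by simpa [F.f_p] using hxy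
  rcases eq_or_ne d c with rfl | hdc
  · have hne := h₅.1 h
    have : e = !d := by
      cases d <;> cases e <;> simp_all
    exact this ▸ he
  · have hc : c = !d := by cases d <;> cases c <;> simp_all
    subst hc
    by_contra h'
    exact h₁ d h (h₅.2 h')

theorem rot_rot {d x y} (hxy : F.f x ≠ F.f y) (h : R d x y) : R d (F.rot x) (F.rot y) := by
  have := F.flip hs hext (by simpa [F.f_p] using hxy) (F.flip hs hext hxy h false) true
  simpa [rot] using this

theorem rot_rot_iff {d x y} (hxy : F.f x ≠ F.f y) (hadj : Adj R x y) :
    R d (F.rot x) (F.rot y) ↔ R d x y := by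
  refine ⟨fun h => hadj.of_not fun h' => ?_, F.rot_rot hs hext hxy⟩
  exact F.colour_unique hs hext (by simpa [F.f_rot] using hxy) h (F.rot_rot hs hext hxy h')

/-- Two cycles can be merged if two vertices `x, t` of one class of the first cycle and two
vertices `y, w` of one class of the second are joined in the pattern of a checkerboard. -/
theorem no_checkerboard {c x t y w} (hxt : F.f x = F.f t) (hxt' : F.cl x = F.cl t)
    (hyw : F.f y = F.f w) (hyw' : F.cl y = F.cl w) (hxy : F.f x ≠ F.f y)
    (h₁ : R c x y) (h₂ : R (!c) x w) (h₃ : R (!c) t y) : ¬ R c t w := by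
  intro h₄
  have hne₁ : x ≠ t := by
    rintro rfl
    exact F.colour_unique hs hext hxy h₁ h₃
  have hne₂ : y ≠ w := by
    rintro rfl
    exact F.colour_unique hs hext hxy h₁ h₂
  obtain ⟨S, T, hST, hST', hS, hT⟩ := F.split c x t hxt hxt' hne₁
  obtain ⟨S', T', hST₂, hST₂', hS', hT'⟩ := F.split c y w hyw hyw' hne₂
  have e₂ := F.flip hs hext (hyw ▸ hxy) h₂ c
  have e₃ := F.flip hs hext (hxt ▸ hxy) h₃ c
  rw [Bool.not_not] at e₂ e₃
  have m₁ : ∀ z ∈ S ∪ T, F.f z = F.f x := fun z hz => by rw [hST'] at hz; exact hz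
  have m₂ : ∀ z ∈ S' ∪ T', F.f z = F.f y := fun z hz => by rw [hST₂'] at hz; exact hz
  have hd : Disjoint (S ∪ T) (S' ∪ T') :=
    Set.disjoint_left.2 fun z h₁ h₂ => hxy ((m₁ z h₁).symm.trans (m₂ z h₂))
  rw [Set.disjoint_union_left, Set.disjoint_union_right, Set.disjoint_union_right] at hd
  obtain ⟨⟨d₁, d₂⟩, d₃, d₄⟩ := hd
  -- The merged cycle runs `p c t … x, y … p c w, p c x … t, w … p c y` and back to `p c t`. The
  -- edges of colour `!c` enter it after `flip` has turned them into edges of colour `c`.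
  have k₁ := hT.append (hT'.symm hs) d₄ h₁
  have k₂ := hS.append (hS'.symm hs) d₁ h₄
  have k := k₁.append k₂ (by
    rw [Set.disjoint_union_left, Set.disjoint_union_right, Set.disjoint_union_right]
    exact ⟨⟨hST.symm, d₃⟩, d₂.symm, hST₂.symm⟩) (hs _ _ _ e₂)
  refine F.irreducible {F.f x, F.f y} x y (by simp) (by simp) hxy c _ _ ?_ (hs _ _ _ e₃)
  convert k using 1
  rw [show T ∪ T' ∪ (S ∪ S') = (S ∪ T) ∪ (S' ∪ T') by ac_rfl, hST', hST₂']
  rfl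

theorem adj_rot_right {x y} (hxy : F.f x ≠ F.f y) (h : Adj R x y) : Adj R x (F.rot y) :=
  F.adj_right hs hext (by simpa [F.f_p] using hxy) (F.adj_right hs hext hxy h false) true

theorem adj_left {x y} (hxy : F.f x ≠ F.f y) (h : Adj R x y) (c : Bool) : Adj R (F.p c x) y :=
  (F.block_structure hs hext hxy h c).2.1

theorem adj_rot_left {x y} (hxy : F.f x ≠ F.f y) (h : Adj R x y) : Adj R (F.rot x) y :=
  F.adj_left hs hext (by simpa [F.f_p] using hxy) (F.adj_left hs hext hxy h false) true

theorem adj_class_right {x y z} (hxy : F.f x ≠ F.f y) (h : Adj R x y) (hyz : F.f y = F.f z)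
    (hyz' : F.cl y = F.cl z) : Adj R x z := by
  obtain ⟨n, rfl⟩ := F.trans y z hyz hyz'
  change Adj R x (F.rot^[n] y)
  have hf : ∀ n, F.f (F.rot^[n] y) = F.f y := fun n => by
    induction n with
    | zero => rfl
    | succ n ih => rw [Function.iterate_succ_apply', F.f_rot, ih]
  clear hyz hyz'
  induction n with
  | zero => exact h
  | succ n ih =>
    rw [Function.iterate_succ_apply']
    exact F.adj_rot_right hs hext (by rwa [hf]) ih

/-- Within the class of `y`, rotation maps the `d`-neighbours of `x` bijectively onto those of `rot
x`. If `y` belonged only to the first set, equal cardinality would give some `w` only in the second,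
and `x, rot x, y, w` would form a checkerboard. -/
theorem rot_left {d x y} (hxy : F.f x ≠ F.f y) (h : R d x y) : R d (F.rot x) y := by
  classical
  have := Fintype.ofFinite V
  refine (F.adj_rot_left hs hext hxy ⟨d, h⟩).of_not fun h' => ?_
  let E := Finset.univ.filter fun w => F.f w = F.f y ∧ F.cl w = F.cl y
  have hE : ∀ w ∈ E, F.f w = F.f y ∧ F.cl w = F.cl y := fun w hw => (Finset.mem_filter.1 hw).2
  have hadj : ∀ w ∈ E, Adj R x w := fun w hw =>
    F.adj_class_right hs hext hxy ⟨d, h⟩ (hE w hw).1.symm (hE w hw).2.symm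
  have hmap : (E.filter fun w => R d x w).image F.rot = (E.filter fun w => R d (F.rot x) w) := by
    have hEimg : E.image F.rot = E := by
      refine Finset.eq_of_subset_of_card_le ?_ (Finset.card_image_of_injective _ F.rot_injective).ge
      intro w hw
      obtain ⟨z, hz, rfl⟩ := Finset.mem_image.1 hw
      simpa [E, F.f_rot, F.cl_rot] using hE z hz
    ext w
    simp only [Finset.mem_image, Finset.mem_filter]
    constructor
    · rintro ⟨z, ⟨hz, hz'⟩, rfl⟩
      exact ⟨hEimg ▸ Finset.mem_image_of_mem _ hz,
        F.rot_rot hs hext ((hE z hz).1 ▸ hxy) hz'⟩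
    · rintro ⟨hw, hw'⟩
      rw [← hEimg] at hw
      obtain ⟨z, hz, rfl⟩ := Finset.mem_image.1 hw
      exact ⟨z, ⟨hz, (F.rot_rot_iff hs hext ((hE z hz).1 ▸ hxy) (hadj z hz)).1 hw'⟩, rfl⟩
  have hcard := congrArg Finset.card hmap
  rw [Finset.card_image_of_injective _ F.rot_injective] at hcard
  have hyE : y ∈ E := by simp [E]
  have : ¬ (E.filter fun w => R d (F.rot x) w) ⊆ E.filter fun w => R d x w := by
    intro hsub
    have heq := Finset.eq_of_subset_of_card_le hsub hcard.le
    have : y ∈ E.filter fun w => R d (F.rot x) w := heq ▸ Finset.mem_filter.2 ⟨hyE, h⟩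
    exact F.colour_unique hs hext (by rwa [F.f_rot]) (Finset.mem_filter.1 this).2 h'
  obtain ⟨w, hw, hw'⟩ := Finset.not_subset.1 this
  rw [Finset.mem_filter] at hw hw'
  have hxw : ¬ R d x w := fun h => hw' ⟨hw.1, h⟩
  have hxw' : R (!d) x w := (hadj w hw.1).of_not (by simpa using hxw)
  exact F.no_checkerboard hs hext (F.f_rot x).symm (F.cl_rot x).symm (hE w hw.1).1.symm
    (hE w hw.1).2.symm hxy h hxw' h' hw.2

theorem rot_right {d x y} (hxy : F.f x ≠ F.f y) (h : R d x y) : R d x (F.rot y) := by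
  refine (F.adj_rot_right hs hext hxy ⟨d, h⟩).of_not fun h' => ?_
  exact F.colour_unique hs hext (by simpa [F.f_rot] using hxy) (F.rot_rot hs hext hxy h)
    (F.rot_left hs hext (by rwa [F.f_rot]) h')

theorem class_right {d x y z} (hxy : F.f x ≠ F.f y) (h : R d x y) (hyz : F.f y = F.f z)
    (hyz' : F.cl y = F.cl z) : R d x z := by
  obtain ⟨n, rfl⟩ := F.trans y z hyz hyz'
  change R d x (F.rot^[n] y)
  have hf : ∀ n, F.f (F.rot^[n] y) = F.f y := fun n => by
    induction n with
    | zero => rfl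
    | succ n ih => rw [Function.iterate_succ_apply', F.f_rot, ih]
  clear hyz hyz'
  induction n with
  | zero => exact h
  | succ n ih =>
    rw [Function.iterate_succ_apply']
    exact F.rot_right hs hext (by rwa [hf]) ih

theorem class_left {d x y z} (hxy : F.f x ≠ F.f y) (h : R d x y) (hxz : F.f x = F.f z)
    (hxz' : F.cl x = F.cl z) : R d z y :=
  hs _ _ _ (F.class_right hs hext hxy.symm (hs _ _ _ h) hxz hxz')

end MinFactor
end AltColour

/-! ### Domination between cycles. -/

namespace AltColour

/-- `AltReach R c u v`: there is an alternating walk from `u` to `v` whose first edge has the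
colour `c`. -/
inductive AltReach {V : Type*} (R : Bool → V → V → Prop) : Bool → V → V → Prop
  | single {c : Bool} {u v : V} : R c u v → AltReach R c u v
  | cons {c : Bool} {u w v : V} : R c u w → AltReach R (!c) w v → AltReach R c u v

namespace MinFactor

variable {V : Type*} {R : Bool → V → V → Prop}
variable (F : MinFactor R)

/-- The vertex `x` is joined by colour `c` to all vertices of the cycle of `y`. -/
def Dom (c : Bool) (x y : V) : Prop :=
  F.f x ≠ F.f y ∧ ∀ z, F.f z = F.f y → R c x z

variable (hs : ∀ c x y, R c x y → R c y x)
variable (hext : ∀ c x y z, R c x y → R c y z → Adj R x z ∨ ∀ d w, R d x w ↔ R d z w)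
variable {F}

theorem Dom.rel {c x y z} (h : F.Dom c x y) (hyz : F.f z = F.f y) : R c x z := h.2 z hyz

theorem Dom.right {c x y z} (h : F.Dom c x y) (hyz : F.f z = F.f y) : F.Dom c x z :=
  ⟨hyz ▸ h.1, hyz ▸ h.2⟩

variable [Finite V]
include hs hext

theorem Dom.same_class {c x y w} (h : F.Dom c x y) (hxw : F.f x = F.f w)
    (hxw' : F.cl x = F.cl w) : F.Dom c w y :=
  ⟨hxw ▸ h.1, fun z hz => F.class_left hs hext (hz ▸ h.1) (h.2 z hz) hxw hxw'⟩

theorem Dom.partner {c x y} (h : F.Dom c x y) (e : Bool) : F.Dom (!c) (F.p e x) y := by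
  refine ⟨by rw [F.f_p]; exact h.1, fun z hz => ?_⟩
  have := F.flip hs hext (x := x) (y := F.p e z) (by rw [F.f_p, hz]; exact h.1)
    (h.2 _ (by rw [F.f_p, hz])) e
  rwa [F.invol] at this

theorem Dom.other_class {c x y w} (h : F.Dom c x y) (hxw : F.f x = F.f w)
    (hxw' : F.cl x ≠ F.cl w) : F.Dom (!c) w y := by
  refine (h.partner hs hext true).same_class hs hext (by rw [F.f_p, hxw]) ?_
  rw [F.cl_p]
  revert hxw'
  cases F.cl x <;> cases F.cl w <;> simp

theorem Dom.exists_colour {c x y} (h : F.Dom c x y) (d : Bool) :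
    ∃ w, F.f w = F.f x ∧ F.Dom d w y := by
  rcases eq_or_ne c d with rfl | hne
  · exact ⟨x, rfl, h⟩
  · refine ⟨F.p true x, F.f_p _ _, ?_⟩
    have : d = !c := by cases c <;> cases d <;> simp_all
    exact this ▸ h.partner hs hext true

theorem Dom.adj {c x y x' y'} (h : F.Dom c x y) (hx : F.f x = F.f x') (hy : F.f y' = F.f y) :
    Adj R x' y' := by
  by_cases hc : F.cl x = F.cl x'
  · exact ⟨_, (h.same_class hs hext hx hc).rel hy⟩
  · exact ⟨_, (h.other_class hs hext hx hc).rel hy⟩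

/-- If `x` sees both classes of the other cycle in one colour, it dominates. If it sees them in two
colours, `flip` shows that `y` sees both classes of the cycle of `x` in one colour. -/
theorem dom_or_dom {x y} (hxy : F.f x ≠ F.f y) (h : Adj R x y) :
    (∃ c, F.Dom c x y) ∨ ∃ c, F.Dom c y x := by
  obtain ⟨b, hb⟩ := F.adj_right hs hext hxy h false
  obtain ⟨a, ha⟩ := h
  have hcl : ∀ u v : V, F.cl u ≠ F.cl v → F.cl (F.p false u) = F.cl v := fun u v h => by
    rw [F.cl_p]; revert h; cases F.cl u <;> cases F.cl v <;> simp
  rcases eq_or_ne a b with rfl | hne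
  · refine Or.inl ⟨a, hxy, fun z hz => ?_⟩
    by_cases hc : F.cl y = F.cl z
    · exact F.class_right hs hext hxy ha hz.symm hc
    · exact F.class_right hs hext (by rwa [F.f_p]) hb (by rw [F.f_p, hz]) (hcl _ _ hc)
  · have : b = !a := by cases a <;> cases b <;> simp_all
    subst this
    have hb' := F.flip hs hext (by rwa [F.f_p]) hb false
    rw [F.invol, Bool.not_not] at hb'
    refine Or.inr ⟨a, hxy.symm, fun z hz => hs _ _ _ ?_⟩
    by_cases hc : F.cl x = F.cl z
    · exact F.class_left hs hext hxy ha hz.symm hc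
    · exact F.class_left hs hext (by rwa [F.f_p]) hb' (by rw [F.f_p, hz]) (hcl _ _ hc)

theorem Dom.asymm {c d x y x'} (h : F.Dom c x y) (h' : F.Dom d y x') (hx : F.f x = F.f x') :
    False := by
  have h₁ := F.colour_eq hs hext h.1 (h.rel rfl) (hs _ _ _ (h'.rel hx))
  have h₂ := F.colour_eq hs hext (h.partner hs hext true).1 ((h.partner hs hext true).rel rfl)
    (hs _ _ _ (h'.rel (by rw [F.f_p, hx])))
  cases c <;> cases d <;> simp_all

omit hs hext [Finite V] in
theorem disjoint_parts {x y : V} (hxy : F.f x ≠ F.f y) :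
    Disjoint {z | F.f z = F.f x} {z | F.f z = F.f y} :=
  Set.disjoint_left.2 fun _ h₁ h₂ => hxy (h₁.symm.trans h₂)

/-- A vertex sees all cycles that are dominated by its cycle in the same colour: otherwise two of
them could be inserted into its cycle. -/
theorem Dom.colour_eq {c d y x z} (h : F.Dom c y x) (h' : F.Dom d y z) : c = d := by
  by_cases hxz : F.f z = F.f x
  · exact F.colour_eq hs hext h.1 (h.rel rfl) (h'.rel hxz.symm)
  by_contra hne
  have : d = !c := by cases c <;> cases d <;> simp_all
  subst this
  obtain ⟨S, T, hST, hST', hS, hT⟩ := F.split c y (F.rot y) (F.f_rot y).symm (F.cl_rot y).symm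
    (F.rot_ne y).symm
  have ht := h.same_class hs hext (F.f_rot y).symm (F.cl_rot y).symm
  have ht' := (h'.same_class hs hext (F.f_rot y).symm (F.cl_rot y).symm).partner hs hext c
  have hy' := h'.partner hs hext c
  rw [Bool.not_not] at ht' hy'
  have hd₁ : Disjoint (S ∪ T) {w | F.f w = F.f x} := hST' ▸ disjoint_parts h.1
  have hd₂ : Disjoint (S ∪ T) {w | F.f w = F.f z} := hST' ▸ disjoint_parts h'.1
  rw [Set.disjoint_union_left] at hd₁ hd₂
  -- Cutting the cycle of `y` at the `c`-edges of `y` and `rot y` leaves two segments. The cycle of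
  -- `x` is inserted between the ends `y` and `rot y`, that of `z` between their `c`-partners, which
  -- see it in colour `c`.
  have k₁ := hT.append ((F.whole c x).symm hs) hd₁.2 (h.rel rfl)
  have k₂ := (hS.symm hs).append ((F.whole c z).symm hs) hd₂.1 (hy'.rel rfl)
  have k := k₁.append k₂ (by
    rw [Set.disjoint_union_left, Set.disjoint_union_right, Set.disjoint_union_right]
    exact ⟨⟨hST.symm, hd₂.2⟩, hd₁.1.symm, disjoint_parts (Ne.symm hxz)⟩)
    (hs _ _ _ (ht.rel (F.f_p _ _)))
  refine F.irreducible {F.f y, F.f x, F.f z} y x (by simp) (by simp) h.1 c _ _ ?_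
    (hs _ _ _ (ht'.rel (F.f_p c z)))
  convert k using 1
  rw [show T ∪ {w | F.f w = F.f x} ∪ (S ∪ {w | F.f w = F.f z}) =
    (S ∪ T) ∪ ({w | F.f w = F.f x} ∪ {w | F.f w = F.f z}) by ac_rfl, hST']
  rfl

/-- The cycle of `y` contains vertices seeing `z` in either colour; one of them makes a
monochromatic path of two edges from `x` to `z`. -/
theorem Dom.adj_of_dom {c d x y z} (h : F.Dom c x y) (h' : F.Dom d y z) (hxz : F.f x ≠ F.f z) :
    Adj R x z := by
  obtain ⟨y', hy', hd⟩ := h'.exists_colour hs hext c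
  exact F.adj_of_mono hs hext hxz (h.rel hy') (hd.rel rfl)

/-- In every orientation of the two dominations a monochromatic path through the middle cycle can be
chosen. When the middle cycle dominates both others, this needs `Dom.colour_eq`. -/
theorem adj_trans {x y z} (hxy : F.f x ≠ F.f y) (hyz : F.f y ≠ F.f z) (hxz : F.f x ≠ F.f z)
    (h₁ : Adj R x y) (h₂ : Adj R y z) : Adj R x z := by
  rcases dom_or_dom hs hext hxy h₁ with ⟨c, h₁⟩ | ⟨c, h₁⟩ <;>
    rcases dom_or_dom hs hext hyz h₂ with ⟨d, h₂⟩ | ⟨d, h₂⟩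
  · exact h₁.adj_of_dom hs hext h₂ hxz
  · obtain ⟨z', hz', hd⟩ := h₂.exists_colour hs hext c
    have hxz' : F.f x ≠ F.f z' := hz' ▸ hxz
    rcases dom_or_dom hs hext hxz'
      (F.adj_of_mono hs hext hxz' (h₁.rel rfl) (hs _ _ _ (hd.rel rfl))) with ⟨e, h⟩ | ⟨e, h⟩
    · exact h.adj hs hext rfl hz'.symm
    · exact (h.adj hs hext hz' rfl).symm hs
  · obtain rfl := h₁.colour_eq hs hext h₂
    exact F.adj_of_mono hs hext hxz (hs _ _ _ (h₁.rel rfl)) (h₂.rel rfl)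
  · exact (h₂.adj_of_dom hs hext h₁ hxz.symm).symm hs

theorem adj_congr {x y x' y'} (hxy : F.f x ≠ F.f y) (h : Adj R x y) (hx : F.f x = F.f x')
    (hy : F.f y = F.f y') : Adj R x' y' := by
  rcases dom_or_dom hs hext hxy h with ⟨e, h⟩ | ⟨e, h⟩
  · exact h.adj hs hext hx hy.symm
  · exact (h.adj hs hext hy hx.symm).symm hs

theorem adj_of_reach {c x y} (h : AltReach R c x y) (hxy : F.f x ≠ F.f y) : Adj R x y := by
  induction h with
  | single h => exact ⟨_, h⟩
  | @cons c u w v h _ ih =>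
    by_cases h₁ : F.f u = F.f w
    · exact adj_congr hs hext (h₁ ▸ hxy) (ih (h₁ ▸ hxy)) h₁.symm rfl
    by_cases h₂ : F.f w = F.f v
    · exact adj_congr hs hext h₁ ⟨_, h⟩ rfl h₂
    · exact adj_trans hs hext h₁ h₂ hxy ⟨_, h⟩ (ih h₂)

-- Three whole cycles, each opened at a `c`-edge, are strung together by the dominating edges.
omit hs hext [Finite V] in
theorem no_triangle {c x y z} (h₁ : F.Dom c x y) (h₂ : F.Dom c y z) (h₃ : F.Dom c z x) :
    False := by
  have k := ((F.whole c x).append (F.whole c y) (disjoint_parts h₁.1)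
    (h₁.rel (F.f_p _ _))).append (F.whole c z) (by
      rw [Set.disjoint_union_left]
      exact ⟨(disjoint_parts h₃.1).symm, disjoint_parts h₂.1⟩) (h₂.rel (F.f_p _ _))
  refine F.irreducible {F.f x, F.f y, F.f z} x y (by simp) (by simp) h₁.1 c _ _ ?_
    (h₃.rel (F.f_p c x))
  rw [Set.union_assoc] at k
  exact k

theorem dom_trans {c d x y z} (h₁ : F.Dom c x y) (h₂ : F.Dom d y z) : ∃ e, F.Dom e x z := by
  by_cases hxz : F.f x = F.f z
  · exact (h₁.asymm hs hext (h₂.right hxz) rfl).elim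
  rcases dom_or_dom hs hext hxz (h₁.adj_of_dom hs hext h₂ hxz) with h | ⟨e, h⟩
  · exact h
  · obtain ⟨y', hy', h₂'⟩ := h₂.exists_colour hs hext c
    obtain ⟨z', hz', h'⟩ := h.exists_colour hs hext c
    exact (no_triangle (h₁.right hy') (h₂'.right hz') h').elim

variable (hreach : ∀ u v c, u ≠ v → AltReach R c u v)
include hreach

theorem exists_source [Nonempty V] : ∃ u, ∀ v, F.f u ≠ F.f v → ∃ c, F.Dom c u v := by
  let r : V → V → Prop := fun x y => ∃ c, F.Dom c x y
  have : IsTrans V r := ⟨fun x y z ⟨c, h₁⟩ ⟨d, h₂⟩ => dom_trans hs hext h₁ h₂⟩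
  have : Std.Irrefl r := ⟨fun x ⟨c, h⟩ => h.1 rfl⟩
  obtain ⟨u, -, hu⟩ := (Finite.wellFounded_of_trans_of_irrefl r).has_min Set.univ
    Set.univ_nonempty
  refine ⟨u, fun v huv => ?_⟩
  have hne : u ≠ v := fun h => huv (h ▸ rfl)
  exact (dom_or_dom hs hext huv
    (adj_of_reach hs hext (hreach u v true hne) huv)).resolve_right (hu v trivial)

variable (hirr : ∀ c x, ¬ R c x x)
include hirr

/-- There is only one cycle in the factor. -/
theorem f_eq (x y : V) : F.f x = F.f y := by
  by_contra hxy
  have : Nonempty V := ⟨x⟩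
  obtain ⟨u, hu⟩ := exists_source (F := F) hs hext hreach
  obtain ⟨v, huv⟩ : ∃ v, F.f u ≠ F.f v := by
    by_contra! h
    exact hxy ((h x).symm.trans (h y))
  obtain ⟨c, hc⟩ := hu v huv
  have hout : ∀ w, F.f u ≠ F.f w → F.Dom c u w := fun w hw => by
    obtain ⟨d, hd⟩ := hu w hw
    exact hc.colour_eq hs hext hd ▸ hd
  -- Such a chord would allow the cycle to be re-spanned by a path between the `!k`-partners of `a`
  -- and `b`; both see the cycle of `v` in colour `!k`, so that cycle could be inserted.
  have hclass : ∀ k a b, F.f a = F.f u → F.f b = F.f u → F.cl a = F.cl b → F.Dom k a v →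
      ¬ R (!k) a b := by
    intro k a b ha hb hab hk h
    have hne : a ≠ b := fun e => hirr _ _ (e ▸ h)
    obtain ⟨S, T, hST, hST', hS, hT⟩ := F.split (!k) a b (ha.trans hb.symm) hab hne
    have ka := hk.partner hs hext (!k)
    have kb := (hk.same_class hs hext (ha.trans hb.symm) hab).partner hs hext (!k)
    have k₁ := hS.append (hT.symm hs) hST (hs _ _ _ h)
    rw [hST'] at k₁
    have k₂ := k₁.append (F.whole (!k) v) (disjoint_parts hk.1) (kb.rel (F.f_p _ _))
    exact F.irreducible {F.f a, F.f v} a v (by simp) (by simp) hk.1 _ _ _ k₂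
      (hs _ _ _ (ka.rel rfl))
  -- Invariant of the walk: every edge from the current vertex to another cycle has the colour not
  -- due next. A step therefore stays inside and, by `hclass`, changes class, which flips the
  -- outward colour together with the colour due.
  have hstay : ∀ d a w, AltReach R d a w → F.f a = F.f u → (∀ b, F.f u ≠ F.f b → F.Dom (!d) a b) →
      F.f w = F.f u := by
    intro d a w h
    have step : ∀ d a w, R d a w → F.f a = F.f u → (∀ b, F.f u ≠ F.f b → F.Dom (!d) a b) →
        F.f w = F.f u ∧ F.cl a ≠ F.cl w := by
      intro d a w h ha hd
      have hw : F.f w = F.f u := by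
        by_contra hw
        have := (hd w (Ne.symm hw))
        have := F.colour_eq hs hext this.1 h (this.rel rfl)
        cases d <;> simp at this
      refine ⟨hw, fun hcl => hclass (!d) a w ha hw hcl (hd v huv) ?_⟩
      rwa [Bool.not_not]
    induction h with
    | single h => exact fun ha hd => (step _ _ _ h ha hd).1
    | @cons d a b w h _ ih =>
      intro ha hd
      obtain ⟨hb, hcl⟩ := step _ _ _ h ha hd
      exact ih hb fun b' hb' => (hd b' hb').other_class hs hext (ha.trans hb.symm) hcl
  refine huv (hstay (!c) u v (hreach u v _ fun h => huv (h ▸ rfl)) rfl fun b hb => ?_).symm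
  rw [Bool.not_not]
  exact hout b hb

end MinFactor
end AltColour

/-! ### Cyclic sequences and minimal cycle factors. -/

namespace AltColour

/-- An alternating cycle with vertex set `S`, as a cyclic sequence of vertices: the edge from
`X i` to `X (i + 1)` has the colour `col i`. -/
structure AltRing {V : Type*} (R : Bool → V → V → Prop) (S : Set V) where
  n : ℕ
  three_le : 3 ≤ n
  X : ZMod n → V
  col : ZMod n → Bool
  inj : Function.Injective X
  range : Set.range X = S
  rel : ∀ i, R (col i) (X i) (X (i + 1))
  col_succ : ∀ i, col (i + 1) = !col i

/-- The part of a `MinFactor` that concerns a single cycle with vertex set `S`. -/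
structure CycleData {V : Type*} (R : Bool → V → V → Prop) (S : Set V) (p : Bool → V → V)
    (cl : V → Bool) : Prop where
  mem : ∀ c, ∀ x ∈ S, p c x ∈ S
  rel : ∀ c, ∀ x ∈ S, R c x (p c x)
  invol : ∀ c, ∀ x ∈ S, p c (p c x) = x
  p_ne : ∀ x ∈ S, p true x ≠ p false x
  cl_p : ∀ c, ∀ x ∈ S, cl (p c x) = !cl x
  trans : ∀ x ∈ S, ∀ y ∈ S, cl x = cl y → ∃ n : ℕ, (fun z => p true (p false z))^[n] x = y
  whole : ∀ c, ∀ x ∈ S, Seg R c S (p c x) x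
  split : ∀ c, ∀ x ∈ S, ∀ t ∈ S, cl x = cl t → x ≠ t → ∃ A B, Disjoint A B ∧
    A ∪ B = S ∧ Seg R c A (p c x) t ∧ Seg R c B (p c t) x

variable {V : Type*} {R : Bool → V → V → Prop}

namespace AltRing

variable {S : Set V} (C : AltRing R S)

theorem col_pred (i : ZMod C.n) : C.col (i - 1) = !C.col i := by
  have := C.col_succ (i - 1)
  rw [sub_add_cancel] at this
  rw [this, Bool.not_not]

theorem col_add_even (i : ZMod C.n) (m : ℕ) : C.col (i + (2 * m : ℕ)) = C.col i := by
  induction m with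
  | zero => simp
  | succ m ih =>
    rw [show i + ((2 * (m + 1) : ℕ) : ZMod C.n) = i + (2 * m : ℕ) + 1 + 1 by push_cast; ring,
      C.col_succ, C.col_succ, ih, Bool.not_not]

theorem even_of_col {i : ZMod C.n} {m : ℕ} (h : C.col (i + m) = C.col i) : Even m := by
  by_contra hm
  obtain ⟨k, rfl⟩ := Nat.not_even_iff_odd.1 hm
  rw [Nat.cast_add, Nat.cast_one, ← add_assoc, C.col_succ, C.col_add_even] at h
  simp at h

theorem even_n : Even C.n := C.even_of_col (i := 0) (by simp)

theorem X_add_inj {i : ZMod C.n} {a b : ℕ} (ha : a < C.n) (hb : b < C.n)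
    (h : C.X (i + a) = C.X (i + b)) : a = b := by
  have := add_left_cancel (C.inj h)
  rwa [ZMod.natCast_eq_natCast_iff', Nat.mod_eq_of_lt ha, Nat.mod_eq_of_lt hb] at this

theorem exists_nat (i j : ZMod C.n) : ∃ d : ℕ, d < C.n ∧ j = i + d := by
  have : NeZero C.n := ⟨by have := C.three_le; lia⟩
  exact ⟨(j - i).val, ZMod.val_lt _, by simp⟩

/-- The vertices of the arc of `l` vertices that starts at `X j`. -/
def arc (j : ZMod C.n) (l : ℕ) : Set V := (fun m : ℕ => C.X (j + m)) '' Set.Iio l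

theorem seg_arc {c : Bool} {j : ZMod C.n} (hj : C.col j = !c) (k : ℕ) (hk : 2 * k + 2 ≤ C.n) :
    Seg R c (C.arc j (2 * k + 2)) (C.X j) (C.X (j + (2 * k : ℕ) + 1)) := by
  induction k with
  | zero =>
    have := Seg.edge (R := R) (c := c) (a := C.X j) (b := C.X (j + 1)) ?_ (hj ▸ C.rel j)
    · have he : C.arc j (2 * 0 + 2) = {C.X j, C.X (j + 1)} := by
        rw [arc, show Set.Iio (2 * 0 + 2) = ({0, 1} : Set ℕ) by ext m; simp; lia]
        simp [Set.image_pair]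
      rw [he]
      simpa using this
    · intro h
      have := C.X_add_inj (i := j) (a := 0) (b := 1) (by lia) (by lia) (by simpa using h)
      simp at this
  | succ k ih =>
    have hcol := C.col_add_even j (k + 1)
    have e : j + ((2 * (k + 1) : ℕ) : ZMod C.n) = j + (2 * k : ℕ) + 1 + 1 := by
      push_cast; ring
    have hedge := Seg.edge (R := R) (c := c) (a := C.X (j + (2 * (k + 1) : ℕ)))
      (b := C.X (j + (2 * (k + 1) : ℕ) + 1)) ?_ (by rw [← hj, ← hcol]; exact C.rel _)
    · have := (ih (by lia)).append hedge ?_ ?_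
      · convert this using 1
        rw [arc, arc, show Set.Iio (2 * (k + 1) + 2) =
          Set.Iio (2 * k + 2) ∪ {2 * (k + 1), 2 * (k + 1) + 1} by ext m; simp; lia,
          Set.image_union, Set.image_pair]
        push_cast
        simp only [add_assoc]
      · rw [Set.disjoint_left]
        rintro _ ⟨m, hm, rfl⟩ hz
        rw [Set.mem_Iio] at hm
        rcases hz with hz | hz
        · have := C.X_add_inj (by lia) (by lia) hz
          lia
        · rw [Set.mem_singleton_iff, add_assoc, ← Nat.cast_succ] at hz
          have := C.X_add_inj (by lia) (by lia) hz
          lia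
      · have := C.rel (j + (2 * k : ℕ) + 1)
        rw [C.col_succ, C.col_add_even, hj, Bool.not_not] at this
        rwa [e]
    · intro h
      rw [add_assoc, ← Nat.cast_succ] at h
      have := C.X_add_inj (by lia) (by lia) h
      lia

theorem seg_arc_of_even {c : Bool} {j : ZMod C.n} (hj : C.col j = !c) {l : ℕ} (hl : Even l) (h0 : 0 < l)
    (hl' : l ≤ C.n) : Seg R c (C.arc j l) (C.X j) (C.X (j + l - 1)) := by
  obtain ⟨k, rfl⟩ : ∃ k, l = 2 * k + 2 := by
    obtain ⟨k, rfl⟩ := hl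
    exact ⟨k - 1, by lia⟩
  convert C.seg_arc hj k hl' using 2
  push_cast
  ring

theorem arc_union (j : ZMod C.n) {d : ℕ} (hd : d ≤ C.n) :
    Disjoint (C.arc j d) (C.arc (j + d) (C.n - d)) ∧
      C.arc j d ∪ C.arc (j + d) (C.n - d) = S := by
  constructor
  · rw [Set.disjoint_left]
    rintro _ ⟨m, hm, rfl⟩ ⟨m', hm', h⟩
    rw [Set.mem_Iio] at hm hm'
    simp only [add_assoc, ← Nat.cast_add] at h
    have := C.X_add_inj (by lia) (by lia) h
    lia
  · refine Eq.trans ?_ C.range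
    apply subset_antisymm
    · rintro _ (⟨m, hm, rfl⟩ | ⟨m, hm, rfl⟩) <;> exact ⟨_, rfl⟩
    · rintro _ ⟨i, rfl⟩
      obtain ⟨m, hm, rfl⟩ := C.exists_nat j i
      by_cases h : m < d
      · exact Or.inl ⟨m, h, rfl⟩
      · refine Or.inr ⟨m - d, by rw [Set.mem_Iio]; lia, ?_⟩
        simp only [add_assoc, ← Nat.cast_add]
        rw [Nat.add_sub_cancel' (by lia)]

theorem arc_n (j : ZMod C.n) : C.arc j C.n = S := by
  have := (C.arc_union j le_rfl).2
  simpa [arc] using this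

-- The class of a vertex is the colour of the edge that leaves it in the cyclic order. Arcs with an
-- even number of vertices give the segments.
include C in
theorem exists_cycleData (hs : ∀ c x y, R c x y → R c y x) : ∃ p cl, CycleData R S p cl := by
  classical
  have : NeZero C.n := ⟨by have := C.three_le; lia⟩
  have hn := C.three_le
  let idx : V → ZMod C.n := Function.invFun C.X
  have hidx : ∀ i, idx (C.X i) = i := Function.leftInverse_invFun C.inj
  let p : Bool → V → V := fun c x =>
    if C.col (idx x) = c then C.X (idx x + 1) else C.X (idx x - 1)
  have p₁ : ∀ {c i}, C.col i = c → p c (C.X i) = C.X (i + 1) := fun h => by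
    simp only [p, hidx, if_pos h]
  have p₂ : ∀ {c i}, C.col i = (!c) → p c (C.X i) = C.X (i - 1) := fun {c i} h => by
    have : C.col i ≠ c := by rw [h]; cases c <;> simp
    simp only [p, hidx, if_neg this]
  have hS : ∀ {P : V → Prop}, (∀ i, P (C.X i)) → ∀ x ∈ S, P x := by
    intro P h x hx
    rw [← C.range] at hx
    obtain ⟨i, rfl⟩ := hx
    exact h i
  have hmem : ∀ i, C.X i ∈ S := fun i => C.range.subset ⟨i, rfl⟩
  have hcol : ∀ c i, C.col i = c ∨ C.col i = !c := fun c i => by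
    cases C.col i <;> cases c <;> simp
  refine ⟨p, fun x => C.col (idx x), ?_, ?_, ?_, ?_, ?_, ?_, ?_, ?_⟩
  · refine fun c => hS fun i => ?_
    rcases hcol c i with h | h
    · rw [p₁ h]; exact hmem _
    · rw [p₂ h]; exact hmem _
  · refine fun c => hS fun i => ?_
    rcases hcol c i with h | h
    · rw [p₁ h, ← h]; exact C.rel i
    · rw [p₂ h]
      have := C.rel (i - 1)
      rw [C.col_pred, h, Bool.not_not, sub_add_cancel] at this
      exact hs _ _ _ this
  · refine fun c => hS fun i => ?_
    rcases hcol c i with h | h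
    · rw [p₁ h, p₂ (by rw [C.col_succ, h]), add_sub_cancel_right]
    · rw [p₂ h, p₁ (by rw [C.col_pred, h, Bool.not_not]), sub_add_cancel]
  · refine hS fun i => ?_
    have hne : C.X (i + 1) ≠ C.X (i - 1) := by
      intro h
      have := C.X_add_inj (i := i - 1) (a := 2) (b := 0) (by lia) (by lia)
        (by push_cast; rw [add_zero, ← h]; congr 1; ring)
      simp at this
    cases h : C.col i
    · rw [p₁ h, p₂ (c := true) h]; exact hne.symm
    · rw [p₁ h, p₂ (c := false) h]; exact hne
  · refine fun c => hS fun i => ?_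
    rcases hcol c i with h | h
    · rw [p₁ h, hidx, hidx, C.col_succ]
    · rw [p₂ h, hidx, hidx, C.col_pred]
  · refine hS fun i => hS fun j => ?_
    simp only [hidx]
    intro hij
    -- The two-step rotation adds 2 to the index on one class and subtracts 2 on the other, so the
    -- distance is measured from `i` to `j` or from `j` to `i`.
    cases h : C.col i
    · obtain ⟨d, -, rfl⟩ := C.exists_nat i j
      obtain ⟨m, rfl⟩ := even_iff_exists_two_mul.1 (C.even_of_col hij.symm)
      refine ⟨m, ?_⟩
      clear hij
      induction m with
      | zero => simp
      | succ m ih =>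
        have hm := (C.col_add_even i m).trans h
        rw [Function.iterate_succ_apply', ih]
        rw [p₁ hm, p₁ (by rw [C.col_succ, hm, Bool.not_false])]
        congr 1
        push_cast
        ring
    · obtain ⟨d, -, rfl⟩ := C.exists_nat j i
      obtain ⟨m, rfl⟩ := even_iff_exists_two_mul.1 (C.even_of_col hij)
      refine ⟨m, ?_⟩
      rw [hij] at h
      clear hij
      induction m with
      | zero => simp
      | succ m ih =>
        have hm := (C.col_add_even j (m + 1)).trans h
        rw [Function.iterate_succ_apply]
        rw [p₂ (c := false) hm, p₂ (c := true) (by rw [C.col_pred, hm])]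
        convert ih using 3
        push_cast
        ring
  · refine fun c => hS fun i => ?_
    rcases hcol c i with h | h
    · have := C.seg_arc_of_even (c := c) (j := i + 1) (by rw [C.col_succ, h]) C.even_n (by lia) le_rfl
      rw [C.arc_n] at this
      rw [p₁ h]
      simpa using this
    · have := C.seg_arc_of_even h C.even_n (by lia) le_rfl
      rw [C.arc_n] at this
      rw [p₂ h]
      simpa using this.symm hs
  · refine fun c => hS fun i => hS fun j => ?_
    simp only [hidx]
    intro hij hne
    obtain ⟨d, hd, rfl⟩ := C.exists_nat i j
    have hev := C.even_of_col hij.symm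
    have hd0 : 0 < d := by
      rcases Nat.eq_zero_or_pos d with rfl | h
      · simp at hne
      · exact h
    have hev' : Even (C.n - d) := (Nat.even_sub hd.le).2 (by simp [C.even_n, hev])
    have hcast : ((C.n - d : ℕ) : ZMod C.n) = - d := by
      rw [Nat.cast_sub hd.le]; simp
    rcases hcol c i with h | h
    · have hj : C.col (i + d) = c := hij ▸ h
      rw [p₁ h, p₁ hj]
      obtain ⟨h₁, h₂⟩ := C.arc_union (i + 1) hd.le
      refine ⟨_, _, h₁, h₂, ?_, ?_⟩
      · convert C.seg_arc_of_even (c := c) (j := i + 1) (by rw [C.col_succ, h]) hev hd0 hd.le using 2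
        ring
      · have := C.seg_arc_of_even (c := c) (j := i + 1 + d) (l := C.n - d)
          (by rw [add_right_comm, C.col_succ, hj]) hev' (by lia) (by lia)
        rw [hcast] at this
        convert this using 2 <;> ring
    · have hj : C.col (i + d) = !c := hij ▸ h
      rw [p₂ h, p₂ hj]
      obtain ⟨h₁, h₂⟩ := C.arc_union i hd.le
      refine ⟨_, _, h₁.symm, by rw [Set.union_comm, h₂], ?_, ?_⟩
      · have := C.seg_arc_of_even hj hev' (by lia) (by lia)
        rw [hcast] at this
        convert this.symm hs using 2
        ring
      · exact (C.seg_arc_of_even h hev hd0 hd.le).symm hs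

end AltRing

/-- A cycle factor with the smallest possible number of cycles is a `MinFactor`. -/
theorem exists_minFactor [Finite V] (hs : ∀ c x y, R c x y → R c y x) (Cyc : Set V → Prop)
    (hring : ∀ S, Cyc S → Nonempty (AltRing R S))
    (hclose : ∀ c S a b, Seg R c S a b → R c b a → 3 ≤ S.ncard → Cyc S)
    (f₀ : V → V) (hf₀ : ∀ x, Cyc {z | f₀ z = f₀ x}) :
    ∃ F : MinFactor R, ∀ x, Cyc {z | F.f z = F.f x} := by
  classical
  obtain ⟨f, hf, hmin⟩ := (measure fun f : V → V => (Set.range f).ncard).wf.has_min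
    {f | ∀ x, Cyc {z | f z = f x}} ⟨f₀, hf₀⟩
  -- The data are chosen per label, not per vertex, so that vertices of one cycle share them; unused
  -- labels get dummy values.
  have hdata : ∀ a, ∃ q : (Bool → V → V) × (V → Bool),
      (∃ x, f x = a) → CycleData R {z | f z = a} q.1 q.2 := by
    intro a
    by_cases ha : ∃ x, f x = a
    · obtain ⟨x, rfl⟩ := ha
      obtain ⟨C⟩ := hring _ (hf x)
      obtain ⟨p, cl, h⟩ := C.exists_cycleData hs
      exact ⟨(p, cl), fun _ => h⟩
    · exact ⟨(fun _ => id, fun _ => true), fun h => (ha h).elim⟩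
  choose q hq' using hdata
  have hq : ∀ x, CycleData R {z | f z = f x} (q (f x)).1 (q (f x)).2 := fun x => hq' _ ⟨x, rfl⟩
  let p : Bool → V → V := fun c x => (q (f x)).1 c x
  let cl : V → Bool := fun x => (q (f x)).2 x
  have f_p : ∀ c x, f (p c x) = f x := fun c x => (hq x).mem c x rfl
  have hpx : ∀ {x y}, f x = f y → ∀ c, p c x = (q (f y)).1 c x := fun h c => by
    simp only [p, h]
  have hclx : ∀ {x y}, f x = f y → cl x = (q (f y)).2 x := fun h => by simp only [cl, h]
  have cl_p : ∀ c x, cl (p c x) = !cl x := fun c x => by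
    rw [hclx (f_p c x)]; exact (hq x).cl_p c x rfl
  have p_ne : ∀ x, p true x ≠ p false x := fun x => (hq x).p_ne x rfl
  refine ⟨{ f := f, p := p, cl := cl, f_p := f_p, cl_p := cl_p, p_ne := p_ne
            rel := fun c x => (hq x).rel c x rfl
            invol := fun c x => by rw [hpx (f_p c x)]; exact (hq x).invol c x rfl
            trans := ?_
            whole := fun c x => (hq x).whole c x rfl
            split := ?_
            irreducible := ?_ }, hf⟩
  · intro x y hxy hcl
    rw [hclx hxy.symm] at hcl
    obtain ⟨n, hn⟩ := (hq x).trans x rfl y hxy.symm hcl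
    refine ⟨n, ?_⟩
    have key : ∀ n : ℕ, (fun z => p true (p false z))^[n] x =
        (fun z => (q (f x)).1 true ((q (f x)).1 false z))^[n] x ∧
        f ((fun z => p true (p false z))^[n] x) = f x := by
      intro n
      induction n with
      | zero => exact ⟨rfl, rfl⟩
      | succ n ih =>
        rw [Function.iterate_succ_apply', Function.iterate_succ_apply', ← ih.1]
        refine ⟨?_, by rw [f_p, f_p]; exact ih.2⟩
        rw [hpx ((f_p _ _).trans ih.2), hpx ih.2]
    rw [(key n).1, hn]
  · intro c x t hxt hcl hne
    rw [hclx hxt.symm] at hcl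
    rw [hpx hxt.symm]
    exact (hq x).split c x rfl t hxt.symm hcl hne
  · intro T x y hx hy hxy c a b hseg hab
    have hx_ne : ∀ c, x ≠ p c x := fun c h => by
      have := cl_p c x
      rw [← h] at this
      cases h' : cl x <;> simp [h'] at this
    have hcyc : Cyc {z | f z ∈ T} := by
      refine hclose c _ a b hseg hab ?_
      rw [← Set.ncard_eq_three.2 ⟨x, p true x, p false x, hx_ne _, hx_ne _, p_ne x, rfl⟩]
      refine Set.ncard_le_ncard ?_
      rintro z (rfl | rfl | rfl)
      · exact hx
      · rw [Set.mem_ofPred_eq, f_p]; exact hx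
      · rw [Set.mem_ofPred_eq, f_p]; exact hx
    -- Giving all labels in `T` the value `f x` is again a factor, and it loses the label `f y`.
    refine hmin (fun z => if f z ∈ T then f x else f z) (fun w => ?_) ?_
    · dsimp only
      by_cases hw : f w ∈ T
      · convert hcyc using 1
        ext z
        rw [Set.mem_ofPred_eq, Set.mem_ofPred_eq, if_pos hw]
        split_ifs with hz
        · simp [hz]
        · simp only [hz, iff_false]
          exact fun h => hz (h ▸ hx)
      · convert hf w using 1
        ext z
        rw [Set.mem_ofPred_eq, Set.mem_ofPred_eq, if_neg hw]
        split_ifs with hz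
        · exact ⟨fun h => (hw (h ▸ hx)).elim, fun h => (hw (h ▸ hz)).elim⟩
        · rfl
    · refine Set.ncard_lt_ncard (Set.ssubset_iff_of_subset ?_ |>.2 ⟨f y, ⟨y, rfl⟩, ?_⟩)
      · rintro _ ⟨z, rfl⟩
        dsimp only
        split_ifs
        exacts [⟨x, rfl⟩, ⟨z, rfl⟩]
      · rintro ⟨z, hz⟩
        dsimp only at hz
        split_ifs at hz with h
        · exact hxy hz
        · exact h (hz ▸ hy)

/-- In the abstract setting: an alternating cycle factor can be merged to one cycle. -/
theorem cyc_univ [Finite V] [Nonempty V] (hs : ∀ c x y, R c x y → R c y x)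
    (hirr : ∀ c x, ¬ R c x x)
    (hext : ∀ c x y z, R c x y → R c y z → Adj R x z ∨ ∀ d w, R d x w ↔ R d z w)
    (hreach : ∀ u v c, u ≠ v → AltReach R c u v) (Cyc : Set V → Prop)
    (hring : ∀ S, Cyc S → Nonempty (AltRing R S))
    (hclose : ∀ c S a b, Seg R c S a b → R c b a → 3 ≤ S.ncard → Cyc S)
    (f₀ : V → V) (hf₀ : ∀ x, Cyc {z | f₀ z = f₀ x}) : Cyc Set.univ := by
  obtain ⟨F, hF⟩ := exists_minFactor hs Cyc hring hclose f₀ hf₀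
  obtain ⟨x⟩ := ‹Nonempty V›
  convert hF x using 1
  exact (Set.eq_univ_of_forall fun z => MinFactor.f_eq hs hext hreach hirr z x).symm

end AltColour

/-! ### Translation between multigraphs and colour relations. -/

namespace AltColour

variable {γ δ : Type*} {G : Graph γ δ} {φ : δ → Fin 2}

/-- The two colours as Booleans. -/
def bcol (i : Fin 2) : Bool := decide (i = 1)

theorem ne_iff_bcol {i j : Fin 2} : i ≠ j ↔ bcol j = !bcol i := by
  revert i j; decide

theorem bcol_eq_iff {i j : Fin 2} : bcol i = bcol j ↔ i = j := by
  revert i j; decide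

theorem exists_bcol (c : Bool) : ∃ i, bcol i = c := by
  revert c; decide

/-- Two vertices of `G` are joined by an edge of colour `c`. -/
def ColAdj (G : Graph γ δ) (φ : δ → Fin 2) (c : Bool) (x y : G.vertexSet) : Prop :=
  ∃ e, G.IsLink e x y ∧ bcol (φ e) = c

theorem colAdj_symm (c : Bool) (x y : G.vertexSet) (h : ColAdj G φ c x y) : ColAdj G φ c y x :=
  h.imp fun _ h => ⟨h.1.symm, h.2⟩

theorem isWalkList_append {u m v : γ} {w w' : List (δ × γ)} (h : G.IsWalkList u w m)
    (h' : G.IsWalkList m w' v) : G.IsWalkList u (w ++ w') v := by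
  induction w generalizing u with
  | nil => obtain ⟨-, rfl⟩ := h; exact h'
  | cons s w ih => exact ⟨h.1, ih h.2⟩

theorem isWalkList_single {u v : γ} {e : δ} (h : G.IsLink e u v) : G.IsWalkList u [(e, v)] v :=
  ⟨h, h.right_mem, rfl⟩

/-- Padding the colour sequence with `i` at both ends records that edges of colour `i` may be
attached there; when two segments are glued, the padded sequences overlap in the joining edge. -/
theorem exists_walk_of_seg {c : Bool} {i : Fin 2} (hi : bcol i = c) {S : Set G.vertexSet}
    {a b : G.vertexSet} (h : Seg (ColAdj G φ) c S a b) :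
    ∃ w, G.IsWalkList a w b ∧ ((a : γ) :: w.map Prod.snd).Nodup ∧
      {x | x ∈ (a : γ) :: w.map Prod.snd} = Subtype.val '' S ∧
      (i :: (Graph.colourSeq φ w ++ [i])).IsChain (· ≠ ·) := by
  subst hi
  induction h with
  | @edge a b hab h =>
    obtain ⟨e, he, hc⟩ := h
    refine ⟨[(e, b)], isWalkList_single he, ?_, ?_, ?_⟩
    · simpa using fun h => hab (Subtype.ext h)
    · ext x
      simp [Set.image_pair]
    · have : i ≠ φ e := ne_iff_bcol.2 hc
      simp [Graph.colourSeq, this, this.symm]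
  | @append S T a b d e _ _ hST hbd ih₁ ih₂ =>
    obtain ⟨w₁, hw₁, hn₁, hv₁, hc₁⟩ := ih₁
    obtain ⟨w₂, hw₂, hn₂, hv₂, hc₂⟩ := ih₂
    obtain ⟨g, hg, hgc⟩ := hbd
    rw [bcol_eq_iff] at hgc
    have hd : Disjoint (Subtype.val '' S) (Subtype.val '' T) :=
      (Set.disjoint_image_iff Subtype.val_injective).2 hST
    rw [← hv₁, ← hv₂] at hd
    refine ⟨w₁ ++ (g, (d : γ)) :: w₂, isWalkList_append hw₁ ⟨hg, hw₂⟩, ?_, ?_, ?_⟩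
    · rw [List.map_append, List.map_cons, ← List.cons_append]
      exact List.nodup_append'.2 ⟨hn₁, hn₂, fun x hx hx' => Set.disjoint_left.1 hd hx hx'⟩
    · rw [Set.image_union, ← hv₁, ← hv₂]
      ext x
      simp [or_assoc]
    · have := hc₁.append_overlap (l₁ := i :: Graph.colourSeq φ w₁) (l₂ := [i])
        (l₃ := Graph.colourSeq φ w₂ ++ [i]) hc₂ (by simp)
      simpa [Graph.colourSeq, hgc] using this

/-- Vertex sets of alternating cycles. -/
def Cyc (G : Graph γ δ) (φ : δ → Fin 2) (S : Set G.vertexSet) : Prop :=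
  ∃ w, G.IsAltCycle φ w ∧ Graph.cycleVerts w = Subtype.val '' S

theorem cyc_of_seg {c : Bool} {S : Set G.vertexSet} {a b : G.vertexSet}
    (h : Seg (ColAdj G φ) c S a b) (hab : ColAdj G φ c b a) (hS : 3 ≤ S.ncard) : Cyc G φ S := by
  obtain ⟨e, he, hc⟩ := hab
  obtain ⟨w, hw, hn, hv, hch⟩ := exists_walk_of_seg hc h
  have hperm : ((w ++ [(e, (a : γ))]).map Prod.snd).Perm ((a : γ) :: w.map Prod.snd) := by
    rw [List.map_append]
    exact List.perm_append_singleton _ _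
  have hv' : Graph.cycleVerts (w ++ [(e, (a : γ))]) = Subtype.val '' S := by
    rw [← hv]
    ext x
    exact hperm.mem_iff
  have hn' := hperm.nodup_iff.2 hn
  refine ⟨w ++ [(e, (a : γ))], ⟨⟨a, isWalkList_append hw (isWalkList_single he)⟩, ?_, hn', ?_⟩, hv'⟩
  · classical
    rw [← Set.ncard_image_of_injective _ Subtype.val_injective, ← hv', Graph.cycleVerts] at hS
    have : {x | x ∈ (w ++ [(e, (a : γ))]).map Prod.snd} =
        (((w ++ [(e, (a : γ))]).map Prod.snd).toFinset : Set γ) := by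
      ext
      rw [Finset.mem_coe, List.mem_toFinset]
      rfl
    rw [this, Set.ncard_coe_finset, List.toFinset_card_of_nodup hn', List.length_map] at hS
    exact hS
  · have hrot : (Graph.colourSeq φ (w ++ [(e, (a : γ))]) : Cycle (Fin 2)) =
        (φ e :: Graph.colourSeq φ w : List (Fin 2)) := by
      rw [Cycle.coe_eq_coe]
      simp only [Graph.colourSeq, List.map_append, List.map_cons, List.map_nil]
      exact (List.isRotated_append (l := [φ e])).symm
    rw [hrot, Cycle.chain_coe_cons]
    exact hch

theorem isLink_getElem {u v : γ} {w : List (δ × γ)} (h : G.IsWalkList u w v) (i : ℕ)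
    (hi : i + 1 < w.length) : G.IsLink w[i + 1].1 w[i].2 w[i + 1].2 := by
  induction w generalizing u i with
  | nil => simp at hi
  | cons s w ih =>
    cases i with
    | zero =>
      cases w with
      | nil => simp at hi
      | cons t w => exact h.2.1
    | succ i => exact ih h.2 i (by simpa using hi)

theorem isWalkList_last {u v : γ} {w : List (δ × γ)} (h : G.IsWalkList u w v) (hw : 0 < w.length) :
    w[w.length - 1].2 = v := by
  induction w generalizing u with
  | nil => simp at hw
  | cons s w ih =>
    cases w with
    | nil => exact h.2.2
    | cons t w => simpa using ih h.2 (by simp)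

theorem isLink_mod {u : γ} {w : List (δ × γ)} (h : G.IsWalkList u w u) (i : ℕ)
    (hi : i < w.length) :
    G.IsLink (w[(i + 1) % w.length]'(Nat.mod_lt _ (by lia))).1 w[i].2
      (w[(i + 1) % w.length]'(Nat.mod_lt _ (by lia))).2 := by
  by_cases h' : i + 1 < w.length
  · simp only [Nat.mod_eq_of_lt h']
    exact isLink_getElem h i h'
  · obtain rfl : i = w.length - 1 := by lia
    have h0 : (w.length - 1 + 1) % w.length = 0 := by
      rw [Nat.sub_add_cancel (by lia), Nat.mod_self]
    simp only [h0]
    rw [isWalkList_last h (by lia)]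
    cases w with
    | nil => simp at hi
    | cons s w => exact h.1

theorem chain_mod {α : Type*} {r : α → α → Prop} {l : List α} (h : Cycle.Chain r (l : Cycle α))
    (i : ℕ) (hi : i < l.length) :
    r l[i] (l[(i + 1) % l.length]'(Nat.mod_lt _ (by lia))) := by
  cases l with
  | nil => simp at hi
  | cons a l =>
    rw [Cycle.chain_coe_cons, ← List.cons_append, List.isChain_iff_getElem] at h
    have := h i (by simpa using hi)
    rw [List.getElem_append_left hi] at this
    by_cases h' : i + 1 < (a :: l).length
    · simp only [Nat.mod_eq_of_lt h']
      rwa [List.getElem_append_left h'] at this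
    · obtain rfl : i = l.length := by simp at hi h'; lia
      simpa using this

theorem altRing_of_cyc {S : Set G.vertexSet} (h : Cyc G φ S) :
    Nonempty (AltRing (ColAdj G φ) S) := by
  obtain ⟨w, ⟨⟨u, hu⟩, h3, hn, hc⟩, hv⟩ := h
  have : NeZero w.length := ⟨by lia⟩
  have hlt : ∀ i : ZMod w.length, i.val < w.length := fun i => ZMod.val_lt i
  have hsucc : ∀ i : ZMod w.length, (i + 1).val = (i.val + 1) % w.length := fun i => by
    rw [ZMod.val_add, ZMod.val_one_eq_one_mod, Nat.add_mod_mod]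
  have hlink : ∀ i : ZMod w.length,
      G.IsLink (w[(i + 1).val]'(hlt _)).1 (w[i.val]'(hlt _)).2 (w[(i + 1).val]'(hlt _)).2 :=
    fun i => by simpa only [hsucc] using isLink_mod hu i.val (hlt i)
  have hcol : ∀ i : ZMod w.length,
      φ (w[i.val]'(hlt _)).1 ≠ φ (w[(i + 1).val]'(hlt _)).1 := fun i => by
    have := chain_mod hc i.val (by simpa [Graph.colourSeq] using hlt i)
    simp only [Graph.colourSeq, List.getElem_map, List.length_map] at this
    simpa only [hsucc] using this
  refine ⟨⟨w.length, h3, fun i => ⟨(w[i.val]'(hlt _)).2, (hlink i).left_mem⟩,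
    -- A step stores the edge that enters its vertex, so the edge leaving vertex `i` is found at
    -- index `i + 1`.
    fun i => bcol (φ (w[(i + 1).val]'(hlt _)).1), ?_, ?_, ?_, ?_⟩⟩
  · intro i j hij
    have hij' := congrArg Subtype.val hij
    apply ZMod.val_injective
    have := (List.Nodup.getElem_inj_iff hn (i := i.val) (j := j.val)
      (hi := by simpa using hlt i) (hj := by simpa using hlt j)).1 (by simpa using hij')
    exact this
  · apply Set.image_injective.2 Subtype.val_injective
    rw [← hv, ← Set.range_comp]
    ext x
    simp only [Set.mem_range, Function.comp, Graph.cycleVerts, Set.mem_ofPred_eq]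
    rw [List.mem_iff_getElem]
    constructor
    · rintro ⟨i, rfl⟩
      exact ⟨i.val, by simpa using hlt i, by simp⟩
    · rintro ⟨i, hi, rfl⟩
      rw [List.length_map] at hi
      refine ⟨(i : ZMod w.length), ?_⟩
      simp [ZMod.val_natCast, Nat.mod_eq_of_lt hi]
  · exact fun i => ⟨_, hlink i, rfl⟩
  · exact fun i => ne_iff_bcol.1 (hcol (i + 1))

theorem altReach_of_walk {u v : G.vertexSet} {e : δ} {x : γ} {w : List (δ × γ)}
    (h : G.IsWalkList u ((e, x) :: w) v)
    (hc : (Graph.colourSeq φ ((e, x) :: w)).IsChain (· ≠ ·)) :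
    AltReach (ColAdj G φ) (bcol (φ e)) u v := by
  induction w generalizing u e x with
  | nil =>
    obtain ⟨h₁, -, rfl⟩ := h
    exact .single ⟨e, h₁, rfl⟩
  | cons s w ih =>
    obtain ⟨f, y⟩ := s
    simp only [Graph.colourSeq, List.map_cons, List.isChain_cons_cons] at hc
    refine .cons (w := ⟨x, h.1.right_mem⟩) ⟨e, h.1, rfl⟩ ?_
    rw [← ne_iff_bcol.1 hc.1]
    exact ih h.2 hc.2

/-- The closed walk alternates at `u`, so the two paths start with different colours and one of them
starts with `c`. -/
theorem altReach_of_colourConnected (h : G.ColourConnected φ) (u v : G.vertexSet) (c : Bool)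
    (huv : u ≠ v) : AltReach (ColAdj G φ) c u v := by
  obtain ⟨p, q, hp, hq, hpq⟩ := h u u.2 v v.2 fun h => huv (Subtype.ext h)
  cases p with
  | nil => exact (huv (Subtype.ext hp.walk.2)).elim
  | cons s p =>
    cases q with
    | nil => exact (huv (Subtype.ext hq.walk.2)).elim
    | cons t q =>
      obtain ⟨e, x⟩ := s
      obtain ⟨f, y⟩ := t
      have hne : φ f ≠ φ e := by
        have := hpq
        simp only [Graph.colourSeq, List.map_cons, List.reverse_cons, List.cons_append] at this
        rw [Cycle.chain_coe_cons, List.append_assoc, List.append_assoc, ← List.cons_append,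
          List.isChain_append] at this
        have := this.2.1
        rw [List.isChain_append] at this
        simpa using this.2.1
      by_cases hc : bcol (φ e) = c
      · exact hc ▸ altReach_of_walk hp.walk hp.alternating
      · have : bcol (φ f) = c := by
          have := ne_iff_bcol.1 hne
          revert this hc
          cases bcol (φ f) <;> cases bcol (φ e) <;> cases c <;> simp
        exact this ▸ altReach_of_walk hq.walk hq.alternating

theorem exists_labelling (h : G.HasAltCycleFactor φ) :
    ∃ f : G.vertexSet → G.vertexSet, ∀ x, Cyc G φ {z | f z = f x} := by
  obtain ⟨C, hC, hdisj, hcov⟩ := h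
  have hex : ∀ x : G.vertexSet, ∃ w ∈ C, (x : γ) ∈ Graph.cycleVerts w := fun x => by
    have : (x : γ) ∈ ⋃ w ∈ C, Graph.cycleVerts w := hcov.symm.subset x.2
    simpa using this
  choose W hWC hW using hex
  have hmem : ∀ w ∈ C, ∀ x ∈ Graph.cycleVerts w, x ∈ G.vertexSet := fun w hw x hx =>
    hcov.subset (Set.mem_biUnion hw hx)
  have huniq : ∀ w ∈ C, ∀ w' ∈ C, ∀ x, x ∈ Graph.cycleVerts w → x ∈ Graph.cycleVerts w' →
      w = w' := fun w hw w' hw' x hx hx' => by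
    by_contra hne
    exact Set.disjoint_left.1 (hdisj hw hw' hne) hx hx'
  have hrep : ∀ w ∈ C, ∃ a, a ∈ Graph.cycleVerts w := fun w hw => by
    have := (hC w hw).three_le
    exact ⟨(w[0]).2, List.mem_map_of_mem (List.getElem_mem _)⟩
  choose r hr using hrep
  -- Each vertex is labelled by a chosen representative of its cycle.
  refine ⟨fun x => ⟨r (W x) (hWC x), hmem _ (hWC x) _ (hr _ (hWC x))⟩, fun x => ⟨W x, hC _ (hWC x), ?_⟩⟩
  ext z
  constructor
  · intro hz
    refine ⟨⟨z, hmem _ (hWC x) z hz⟩, ?_, rfl⟩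
    have : W ⟨z, hmem _ (hWC x) z hz⟩ = W x :=
      huniq _ (hWC _) _ (hWC x) z (hW ⟨z, hmem _ (hWC x) z hz⟩) hz
    simp [this]
  · rintro ⟨z, hz, rfl⟩
    have hz' : r (W z) (hWC z) = r (W x) (hWC x) := congrArg Subtype.val hz
    have := huniq _ (hWC z) _ (hWC x) _ (hr _ (hWC z)) (hz' ▸ hr _ (hWC x))
    exact this ▸ hW z

end AltColour

/-! ### The forward direction, and extensions. -/

namespace AltColour

variable {γ δ : Type*} {G : Graph γ δ} {φ : δ → Fin 2}

theorem exists_of_isWalkList_append {u v : γ} {w w' : List (δ × γ)}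
    (h : G.IsWalkList u (w ++ w') v) : ∃ m, G.IsWalkList u w m ∧ G.IsWalkList m w' v := by
  induction w generalizing u with
  | nil =>
    refine ⟨u, ⟨?_, rfl⟩, h⟩
    cases w' with
    | nil => exact h.1
    | cons s w' => exact h.1.left_mem
  | cons s w ih =>
    obtain ⟨m, h₁, h₂⟩ := ih h.2
    exact ⟨m, ⟨h.1, h₁⟩, h₂⟩

theorem exists_reverse_walk {u v : γ} {w : List (δ × γ)} (h : G.IsWalkList v w u) :
    ∃ q, G.IsWalkList u q v ∧ Graph.colourSeq φ q = (Graph.colourSeq φ w).reverse ∧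
      u :: q.map Prod.snd = (v :: w.map Prod.snd).reverse := by
  induction w generalizing v with
  | nil =>
    obtain ⟨h, rfl⟩ := h
    exact ⟨[], ⟨h, rfl⟩, rfl, rfl⟩
  | cons s w ih =>
    obtain ⟨q, hq, hc, hv⟩ := ih h.2
    refine ⟨q ++ [(s.1, v)], isWalkList_append hq (isWalkList_single h.1.symm), ?_, ?_⟩
    · simp only [Graph.colourSeq] at hc
      simp [Graph.colourSeq, hc]
    · rw [List.map_append, ← List.cons_append, hv]
      simp

theorem mem_of_isWalkList {u v : γ} {w : List (δ × γ)} (h : G.IsWalkList u w v) (huv : u ≠ v) :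
    v ∈ w.map Prod.snd := by
  cases w with
  | nil => exact (huv h.2).elim
  | cons s w =>
    rw [← isWalkList_last h (by simp)]
    exact List.mem_map_of_mem (List.getElem_mem _)

theorem isChain_of_cycle_chain {α : Type*} {r : α → α → Prop} {l : List α}
    (h : Cycle.Chain r (l : Cycle α)) : l.IsChain r := by
  cases l with
  | nil => exact .nil
  | cons a l =>
    rw [Cycle.chain_coe_cons, ← List.cons_append] at h
    exact (List.isChain_append.1 h).1

/-- An alternating cycle through `u`, cut open at `u`. -/
theorem exists_rotation {w : List (δ × γ)} (h : G.IsAltCycle φ w) {u : γ}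
    (hu : u ∈ w.map Prod.snd) :
    ∃ w', G.IsWalkList u w' u ∧ w.IsRotated w' := by
  obtain ⟨⟨e, x⟩, hs, rfl⟩ := List.mem_map.1 hu
  obtain ⟨l₁, l₂, rfl⟩ := List.append_of_mem hs
  obtain ⟨t, ht⟩ := h.closed
  obtain ⟨m, h₁, h₂, h₃⟩ := exists_of_isWalkList_append ht
  refine ⟨l₂ ++ (l₁ ++ [(e, x)]),
    isWalkList_append h₃ (isWalkList_append h₁ (isWalkList_single h₂)), ?_⟩
  rw [← List.singleton_append (x := (e, x)), ← List.append_assoc]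
  exact List.isRotated_append

/-- The two arcs between `u` and `v` are the paths, the second one reversed; their closed walk is
the cycle itself. -/
theorem colourConnected_of_altHamCycle (h : G.HasAltHamCycle φ) : G.ColourConnected φ := by
  obtain ⟨w, hw, hV⟩ := h
  intro u hu v hv huv
  rw [← hV] at hu hv
  obtain ⟨w', hw', hrot⟩ := exists_rotation hw hu
  have hv' : v ∈ w'.map Prod.snd := (hrot.perm.map _).mem_iff.1 hv
  have hn : (w'.map Prod.snd).Nodup := (hrot.perm.map _).nodup_iff.1 hw.nodup
  have hc : Cycle.Chain (· ≠ ·) (Graph.colourSeq φ w' : Cycle (Fin 2)) := by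
    rw [Graph.colourSeq, ← Cycle.coe_eq_coe.2 (hrot.map _)]
    exact hw.alternating
  obtain ⟨⟨f, v⟩, hs, rfl⟩ := List.mem_map.1 hv'
  dsimp only at huv
  obtain ⟨r₁, r₂, rfl⟩ := List.append_of_mem hs
  obtain ⟨m, h₁, h₂, h₃⟩ := exists_of_isWalkList_append hw'
  obtain ⟨q, hq, hqc, hqv⟩ := exists_reverse_walk (φ := φ) h₃
  have hur := mem_of_isWalkList h₃ huv.symm
  have hchain := isChain_of_cycle_chain hc
  rw [← List.singleton_append (x := (f, v)), ← List.append_assoc] at hn hc hchain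
  simp only [Graph.colourSeq] at hqc
  rw [Graph.colourSeq, List.map_append] at hc hchain
  rw [List.map_append] at hn
  obtain ⟨hc₁, hc₂, -⟩ := List.isChain_append.1 hchain
  obtain ⟨hn₁, hn₂, hn₃⟩ := List.nodup_append'.1 hn
  refine ⟨r₁ ++ [(f, v)], q, ⟨isWalkList_append h₁ (isWalkList_single h₂), ?_, hc₁⟩,
    ⟨hq, ?_, ?_⟩, ?_⟩
  · exact List.nodup_cons.2 ⟨fun h => hn₃ h hur, hn₁⟩
  · rw [hqv, List.nodup_reverse]
    exact List.nodup_cons.2 ⟨fun h => hn₃ (by simp) h, hn₂⟩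
  · rw [Graph.colourSeq, hqc, List.isChain_reverse]
    exact hc₂.imp fun _ _ h => h.symm
  · rw [Graph.colourSeq, Graph.colourSeq, hqc, List.reverse_reverse]
    exact hc

theorem altCycleFactor_of_altHamCycle (h : G.HasAltHamCycle φ) : G.HasAltCycleFactor φ := by
  obtain ⟨w, hw, hV⟩ := h
  exact ⟨{w}, by simpa using hw, Set.pairwiseDisjoint_singleton _ _, by simpa using hV⟩

section Extension

variable {α β : Type*} {G₀ : Graph α β} {φ₀ : β → Fin 2} {π : γ → α}
  (hπ : ∀ x ∈ G.vertexSet, ∀ y ∈ G.vertexSet, ∀ c : Fin 2,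
    {f | G.IsLink f x y ∧ φ f = c}.encard = {e | G₀.IsLink e (π x) (π y) ∧ φ₀ e = c}.encard)

include hπ

theorem colAdj_iff_base {c : Bool} {x y : G.vertexSet} :
    ColAdj G φ c x y ↔ ∃ e, G₀.IsLink e (π x) (π y) ∧ bcol (φ₀ e) = c := by
  obtain ⟨i, rfl⟩ := exists_bcol c
  have h := hπ x x.2 y y.2 i
  have h' : {f | G.IsLink f x y ∧ φ f = i}.Nonempty ↔
      {e | G₀.IsLink e (π x) (π y) ∧ φ₀ e = i}.Nonempty := by
    rw [← Set.encard_ne_zero, ← Set.encard_ne_zero, h]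
  simp only [ColAdj, bcol_eq_iff]
  exact h'

theorem base_ne [G₀.Loopless] {c : Bool} {x y : G.vertexSet} (h : ColAdj G φ c x y) :
    π x ≠ π y := by
  obtain ⟨e, he, -⟩ := (colAdj_iff_base hπ).1 h
  exact he.ne

/-- Ends over the same base vertex are twins; over different ones, M-closure of the base graph
applies and the edge lifts. -/
theorem adj_or_twin [G₀.Loopless] (hM : G₀.MClosed φ₀) (c : Bool) (x y z : G.vertexSet)
    (h₁ : ColAdj G φ c x y) (h₂ : ColAdj G φ c y z) :
    Adj (ColAdj G φ) x z ∨ ∀ d w, ColAdj G φ d x w ↔ ColAdj G φ d z w := by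
  by_cases hxz : π x = π z
  · exact Or.inr fun d w => by rw [colAdj_iff_base hπ, colAdj_iff_base hπ, hxz]
  · obtain ⟨e, he, hec⟩ := (colAdj_iff_base hπ).1 h₁
    obtain ⟨f, hf, hfc⟩ := (colAdj_iff_base hπ).1 h₂
    obtain ⟨g, hg⟩ := hM e f _ _ _ he hf he.ne hf.ne hxz (bcol_eq_iff.1 (hec.trans hfc.symm))
    exact Or.inl ⟨bcol (φ₀ g), (colAdj_iff_base hπ).2 ⟨g, hg, rfl⟩⟩

end Extension

end AltColour

theorem mainTheorem2 {α β γ δ : Type*}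
    (G₀ : Graph α β) [G₀.Loopless] (φ₀ : β → Fin 2) (hM : G₀.MClosed φ₀)
    (G : Graph γ δ) (φ : δ → Fin 2) (hfin : G.vertexSet.Finite) (hne : G.vertexSet.Nonempty)
    (hG : G₀.IsExtension φ₀ G φ) :
    G.HasAltHamCycle φ ↔ G.ColourConnected φ ∧ G.HasAltCycleFactor φ := by
  refine ⟨fun h => ⟨AltColour.colourConnected_of_altHamCycle h,
    AltColour.altCycleFactor_of_altHamCycle h⟩, fun ⟨hcc, hfac⟩ => ?_⟩
  obtain ⟨π, -, hπ⟩ := hG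
  have : Finite G.vertexSet := hfin
  have : Nonempty G.vertexSet := hne.to_subtype
  obtain ⟨f, hf⟩ := AltColour.exists_labelling hfac
  obtain ⟨w, hw, hV⟩ := AltColour.cyc_univ AltColour.colAdj_symm
    (fun c x h => AltColour.base_ne hπ h rfl) (AltColour.adj_or_twin hπ hM)
    (AltColour.altReach_of_colourConnected hcc) (AltColour.Cyc G φ)
    (fun _ => AltColour.altRing_of_cyc) (fun _ _ _ _ => AltColour.cyc_of_seg) f hf
  exact ⟨w, hw, by simpa using hV⟩
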